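/- Let $A$ be a linear operator on a $2$-dimensional complex Hilbert space $E$ (for instance a complex $2\times 2$ matrix acting on $\mathbb C^2$). Put $$D_A=\det\Bigl(A-\tfrac{\operatorname{tr}A}{2}\mathrm{Id}\Bigr),\qquad U_A=\tfrac12\operatorname{tr}\Bigl(\bigl(A-\tfrac{\operatorname{tr}A}{2}\mathrm{Id}\bigr)^*\bigl(A-\tfrac{\operatorname{tr}A}{2}\mathrm{Id}\bigr)\Bigr).$$ Consider two models of hyperbolic $3$-space of curvature $-1$. In the Beltrami--Cayley--Klein model (BCK) the ordinary points are those of the open unit ball of $\mathbb R^3$, with distance $$d(p,q)=\operatorname{arcosh}\frac{1-p\cdot q}{\sqrt{1-|p|^2}\,\sqrt{1-|q|^2}};$$ in the parabolic model (pCK) they are the points with $x^2+y^2<z$, with the distance transported from BCK by $(x,y,z)\mapsto\frac1{z+1}(2x,2y,z-1)$. A complex number $\lambda$ gives the asymptotic (boundary) point $\iota(\lambda)$, which is $\frac{1}{|\lambda|^2+1}(2\operatorname{Re}\lambda,2\operatorname{Im}\lambda,|\lambda|^2-1)$ in BCK and $(\operatorname{Re}\lambda,\operatorname{Im}\lambda,|\lambda|^2)$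 in pCK. The h-line connecting two different asymptotic points $P,Q$ consists of the ordinary points of the straight line through $P$ and $Q$; the asymptotically closed h-tube of radius $r>0$ around it is the set of ordinary points whose hyperbolic distance from this h-line is $r$, together with $P$ and $Q$; the degenerate h-tube, of radius $r=0$, is the h-line together with $P$ and $Q$. The Davis--Wielandt shell $\mathrm{DW}(A)$ is the set of the points $$\frac{\bigl(2\operatorname{Re}\langle Ax,x\rangle,\;2\operatorname{Im}\langle Ax,x\rangle,\;|Ax|^2-|x|^2\bigr)}{|Ax|^2+|x|^2}\ \text{ in BCK},\qquad \frac{\bigl(\operatorname{Re}\langle Ax,x\rangle,\;\operatorname{Im}\langle Ax,x\rangle,\;|Ax|^2\bigr)}{|x|^2}\ \text{ in pCK},$$ where $x$ runs over the non-zero vectors of $E$ and $\langle\cdot,\cdot\rangle$ is linear in the first variable. (a) Suppose that $A$ has two different eigenvalues $\lambda_1\ne\lambda_2$. Then $U_A\ge|D_A|>0$, and in both models $\mathrm{DW}(A)$ is a possibly degenerate asymptotically closed h-tube around the h-line connecting $\iota(\lambda_1)$ and $\iota(\lambda_2)$, for exactly one radius, namely $$r=\frac12\operatorname{arcosh}\frac{U_A}{|D_A|}=\operatorname{arsinh}\sqrt{\frac{U_A-|D_A|}{2|D_A|}}=\operatorname{artanh}\sqrt{\frac{U_A-|D_A|}{U_A+|D_A|}}.$$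 The h-tube is degenerate, i.e. $r=0$, if and only if $A$ is normal. (b) Suppose that $A$ has only one eigenvalue. Evaluate the three expressions in (a) in $[0,+\infty]$ with $a/0=+\infty$ for $a>0$, $\operatorname{arcosh}(+\infty)=\operatorname{arsinh}(+\infty)=\operatorname{artanh}(1)=+\infty$, and with $0/0$ declared to be $1$ in the first expression and $0$ in the other two. If $A$ is normal, then $U_A=D_A=0$ and the three expressions are $0$ (by this declaration). If $A$ is not normal, then $U_A>0=D_A$ and the three expressions are $+\infty$. -/

import Mathlib

noncomputable section

namespace DavisWielandt

/-! ### The two projective models of hyperbolic 3-space -/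

/-- Ordinary points of the Beltrami-Cayley-Klein model: the open unit ball. -/
def ordBCK : Set (Fin 3 → ℝ) := {p | p 0 ^ 2 + p 1 ^ 2 + p 2 ^ 2 < 1}

/-- Ordinary points of the parabolic Cayley-Klein model: the open solid paraboloid. -/
def ordPCK : Set (Fin 3 → ℝ) := {p | p 0 ^ 2 + p 1 ^ 2 < p 2}

/-- The canonical projective correspondence from the pCK model to the BCK model. -/
def toBCK (p : Fin 3 → ℝ) : Fin 3 → ℝ :=
  ![2 * p 0 / (p 2 + 1), 2 * p 1 / (p 2 + 1), (p 2 - 1) / (p 2 + 1)]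

/-- The hyperbolic distance (curvature `-1`) of ordinary points of the BCK model. -/
def distBCK (p q : Fin 3 → ℝ) : ℝ :=
  Real.arcosh ((1 - p 0 * q 0 - p 1 * q 1 - p 2 * q 2) /
    (√(1 - p 0 ^ 2 - p 1 ^ 2 - p 2 ^ 2) * √(1 - q 0 ^ 2 - q 1 ^ 2 - q 2 ^ 2)))

/-- The hyperbolic distance of ordinary points of the pCK model. -/
def distPCK (p q : Fin 3 → ℝ) : ℝ := distBCK (toBCK p) (toBCK q)

/-- The asymptotic point of the BCK model with complex parameter `l`. -/
def iotaBCK (l : ℂ) : Fin 3 → ℝ :=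
  ![2 * l.re / (‖l‖ ^ 2 + 1), 2 * l.im / (‖l‖ ^ 2 + 1), (‖l‖ ^ 2 - 1) / (‖l‖ ^ 2 + 1)]

/-- The asymptotic point of the pCK model with complex parameter `l`. -/
def iotaPCK (l : ℂ) : Fin 3 → ℝ := ![l.re, l.im, ‖l‖ ^ 2]

/-! ### h-lines and h-tubes

`H` is the set of ordinary points of the model, `d` its distance, and `P`, `Q` are two different
asymptotic points at finite places of the coordinate space. -/

/-- The h-line connecting `P` and `Q`: the ordinary points on the straight line through them. -/
def hLine (H : Set (Fin 3 → ℝ)) (P Q : Fin 3 → ℝ) : Set (Fin 3 → ℝ) :=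
  (line[ℝ, P, Q] : Set (Fin 3 → ℝ)) ∩ H

/-- The ordinary points whose distance from the h-line connecting `P` and `Q` is `r`. -/
def equidistant (H : Set (Fin 3 → ℝ)) (d : (Fin 3 → ℝ) → (Fin 3 → ℝ) → ℝ)
    (P Q : Fin 3 → ℝ) (r : ℝ) : Set (Fin 3 → ℝ) :=
  {p | p ∈ H ∧ IsGLB (d p '' hLine H P Q) r}

/-- `S` is the asymptotically closed h-tube of radius `r > 0` around the h-line connecting
`P` and `Q`. -/
def IsClosedHTube (H : Set (Fin 3 → ℝ)) (d : (Fin 3 → ℝ) → (Fin 3 → ℝ) → ℝ)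
    (P Q : Fin 3 → ℝ) (r : ℝ) (S : Set (Fin 3 → ℝ)) : Prop :=
  0 < r ∧ S = equidistant H d P Q r ∪ {P, Q}

/-- `S` is the possibly degenerate asymptotically closed h-tube of radius `r` around the h-line
connecting `P` and `Q`; the degenerate one, of radius `0`, is the asymptotically closed h-line. -/
def IsPossiblyDegenerateHTube (H : Set (Fin 3 → ℝ))
    (d : (Fin 3 → ℝ) → (Fin 3 → ℝ) → ℝ)
    (P Q : Fin 3 → ℝ) (r : ℝ) (S : Set (Fin 3 → ℝ)) : Prop :=
  IsClosedHTube H d P Q r S ∨ (r = 0 ∧ S = hLine H P Q ∪ {P, Q})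

/-! ### The Davis-Wielandt shell

Mathlib's inner product is conjugate linear in the first variable, so that the product
`⟨A x, x⟩` (linear in the first variable) is `inner ℂ x (A x)`. -/

variable {E : Type*} [NormedAddCommGroup E] [InnerProductSpace ℂ E]

/-- The Davis-Wielandt shell in the BCK model. -/
def shellBCK (A : E →ₗ[ℂ] E) : Set (Fin 3 → ℝ) :=
  {p | ∃ x : E, x ≠ 0 ∧ p =
    ![2 * (inner ℂ x (A x)).re / (‖A x‖ ^ 2 + ‖x‖ ^ 2),
      2 * (inner ℂ x (A x)).im / (‖A x‖ ^ 2 + ‖x‖ ^ 2),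
      (‖A x‖ ^ 2 - ‖x‖ ^ 2) / (‖A x‖ ^ 2 + ‖x‖ ^ 2)]}

/-- The Davis-Wielandt shell in the pCK model. -/
def shellPCK (A : E →ₗ[ℂ] E) : Set (Fin 3 → ℝ) :=
  {p | ∃ x : E, x ≠ 0 ∧ p =
    ![(inner ℂ x (A x)).re / ‖x‖ ^ 2,
      (inner ℂ x (A x)).im / ‖x‖ ^ 2,
      ‖A x‖ ^ 2 / ‖x‖ ^ 2]}

/-! ### Spectral and metric discriminant -/

/-- `A - (tr A / 2) Id`. -/
def traceless (A : E →ₗ[ℂ] E) : E →ₗ[ℂ] E :=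
  A - (LinearMap.trace ℂ E A / 2) • LinearMap.id

/-- The spectral discriminant `D_A = det (A - (tr A / 2) Id)`. -/
def discD (A : E →ₗ[ℂ] E) : ℂ := LinearMap.det (traceless A)

/-- The metric discriminant `U_A = tr ((A - (tr A / 2) Id)* (A - (tr A / 2) Id)) / 2`
(the trace is a real number). -/
def discU [FiniteDimensional ℂ E] (A : E →ₗ[ℂ] E) : ℝ :=
  (LinearMap.trace ℂ E (LinearMap.adjoint (traceless A) ∘ₗ traceless A)).re / 2

end DavisWielandt

/-! ### Extended values, for vanishing denominators -/

namespace DavisWielandt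

/-- The ratio `a / b` of nonnegative numbers with `a / 0 = +∞` for `a > 0`, and with the declared
value `v` for `0 / 0`. -/
def extRatio (v a b : ℝ) : EReal :=
  if b = 0 then (if a = 0 then (v : EReal) else ⊤) else ((a / b : ℝ) : EReal)

/-- The square root on `[0, +∞]`. -/
def extSqrt (x : EReal) : EReal := if x = ⊤ then ⊤ else ((√x.toReal : ℝ) : EReal)

/-- The function `arcosh` on `[1, +∞]`. -/
def extArcosh (x : EReal) : EReal := if x = ⊤ then ⊤ else ((Real.arcosh x.toReal : ℝ) : EReal)

/-- The function `arsinh` on `[0, +∞]`. -/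
def extArsinh (x : EReal) : EReal := if x = ⊤ then ⊤ else ((Real.arsinh x.toReal : ℝ) : EReal)

/-- The function `artanh` on `[0, 1]`. -/
def extArtanh (x : EReal) : EReal := if x = 1 then ⊤ else ((Real.artanh x.toReal : ℝ) : EReal)

end DavisWielandt

end

/-! In an orthonormal basis starting with an eigenvector, `A` is upper triangular with diagonal `l`,
`m` and off-diagonal entry `t`. Then |D| = |l - m|²/4 and U = |l - m|²/4 + |t|²/2, so `t` measures
the failure of normality. For l ≠ m the claimed radius is the r ≥ 0 with cosh² r = 1 + |t|²/|l -
m|².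

In the parabolic model put w = x + iy, W = z - |w|² (`defect`) and a_l = W + |w - l|² (`polar`).
Minimising along a chord shows that the distance d of an ordinary point from the h-line satisfies
cosh² d = a_l a_m / (|l - m|² W) (`mem_equidistantPCK_iff`). At the shell point of a unit vector v,
a_l = |Av - lv|² and a_m = |Av - mv|², while W is the Gram determinant of v and Av. In coordinates
this gives a_l a_m = (|t|² + |l - m|²) W, the equation of the tube. Conversely, every ordinary
solution comes from a vector (`eq_shellPoint_of_mul_eq`), and the eigenvectors supply the two
asymptotic points.

The projective map `toBCK` carries the result to the ball model. For a double eigenvalue, D = 0 and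
U = |t|²/2, and the extended values depend only on whether t = 0. -/

namespace DavisWielandt

/-! ### Schur form and the discriminants -/

section LinearAlgebra

variable {E : Type*} [NormedAddCommGroup E] [InnerProductSpace ℂ E]

/-- The orthonormal basis `b` brings `A` to the upper triangular form with diagonal `l`, `m` and
off-diagonal entry `t`. -/
def IsTriangular (b : OrthonormalBasis (Fin 2) ℂ E) (A : E →ₗ[ℂ] E) (l m t : ℂ) : Prop :=
  A (b 0) = l • b 0 ∧ A (b 1) = t • b 0 + m • b 1

theorem IsTriangular.toMatrixOrthonormal_eq [FiniteDimensional ℂ E]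
    {b : OrthonormalBasis (Fin 2) ℂ E} {A : E →ₗ[ℂ] E} {l m t : ℂ} (h : IsTriangular b A l m t) :
    LinearMap.toMatrixOrthonormal b A = !![l, t; 0, m] := by
  ext i j
  rw [LinearMap.toMatrixOrthonormal_apply_apply]
  fin_cases i <;> fin_cases j <;>
    simp [h.1, h.2, inner_add_right, inner_smul_right]

theorem IsTriangular.toMatrix_eq [FiniteDimensional ℂ E]
    {b : OrthonormalBasis (Fin 2) ℂ E} {A : E →ₗ[ℂ] E} {l m t : ℂ} (h : IsTriangular b A l m t) :
    LinearMap.toMatrix b.toBasis b.toBasis A = !![l, t; 0, m] :=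
  h.toMatrixOrthonormal_eq

theorem exists_isTriangular [FiniteDimensional ℂ E] (hE : Module.finrank ℂ E = 2)
    {A : E →ₗ[ℂ] E} {l : ℂ} (hl : Module.End.HasEigenvalue A l) :
    ∃ (b : OrthonormalBasis (Fin 2) ℂ E) (m t : ℂ), IsTriangular b A l m t := by
  obtain ⟨v, hv⟩ := hl.exists_hasEigenvector
  have hv0 : v ≠ 0 := hv.2
  have hAv : A v = l • v := hv.apply_eq_smul
  -- Only the vector at index `0` is prescribed, so a constant family suffices.
  obtain ⟨b, hb⟩ := Orthonormal.exists_orthonormalBasis_extension_of_card_eq (𝕜 := ℂ) (E := E)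
    (ι := Fin 2) (by simpa using hE) (v := fun _ => ((‖v‖⁻¹ : ℝ) : ℂ) • v) (s := {0}) (by
      constructor
      · rintro ⟨i, hi⟩
        simp [Set.domRestrict, norm_smul, hv0]
      · rintro ⟨i, hi⟩ ⟨j, hj⟩ hij
        simp only [Set.mem_singleton_iff] at hi hj
        subst hi hj
        exact absurd rfl hij)
  have hb0 := hb 0 rfl
  refine ⟨b, inner ℂ (b 1) (A (b 1)), inner ℂ (b 0) (A (b 1)), ?_, ?_⟩
  · rw [hb0, map_smul, hAv, smul_comm]
  · conv_lhs => rw [← b.sum_repr' (A (b 1))]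
    simp [Fin.sum_univ_two]

theorem IsTriangular.hasEigenvalue {b : OrthonormalBasis (Fin 2) ℂ E} {A : E →ₗ[ℂ] E}
    {l m t : ℂ} (h : IsTriangular b A l m t) : Module.End.HasEigenvalue A m := by
  by_cases hlm : m = l
  · subst hlm
    refine Module.End.hasEigenvalue_of_hasEigenvector (x := b 0) ⟨?_, b.orthonormal.ne_zero 0⟩
    rw [Module.End.mem_eigenspace_iff, h.1]
  · refine Module.End.hasEigenvalue_of_hasEigenvector (x := t • b 0 + (m - l) • b 1) ⟨?_, ?_⟩
    · rw [Module.End.mem_eigenspace_iff, map_add, map_smul, map_smul, h.1, h.2]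
      module
    · intro h0
      have := congrArg (fun x => inner ℂ (b 1) x) h0
      simp [sub_eq_zero, hlm] at this

theorem IsTriangular.eq_or_eq {b : OrthonormalBasis (Fin 2) ℂ E} {A : E →ₗ[ℂ] E}
    {l m t k : ℂ} (h : IsTriangular b A l m t) (hk : Module.End.HasEigenvalue A k) :
    k = l ∨ k = m := by
  obtain ⟨v, hv⟩ := hk.exists_hasEigenvector
  have hv0 : v ≠ 0 := hv.2
  have hAv : A v = k • v := hv.apply_eq_smul
  have hsum := b.sum_repr' v
  rw [Fin.sum_univ_two] at hsum
  set x := inner ℂ (b 0) v with hx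
  set y := inner ℂ (b 1) v with hy
  rw [← hsum, map_add, map_smul, map_smul, h.1, h.2] at hAv
  have e0 := congrArg (fun x => inner ℂ (b 0) x) hAv
  have e1 := congrArg (fun x => inner ℂ (b 1) x) hAv
  simp at e0 e1
  by_cases hy0 : y = 0
  · have hx0 : x ≠ 0 := by
      rintro hx0
      rw [hx0, hy0] at hsum
      exact hv0 (by simpa using hsum.symm)
    left
    rw [hy0] at e0
    apply mul_right_cancel₀ hx0
    linear_combination -e0
  · right
    apply mul_right_cancel₀ hy0
    linear_combination -e1

theorem IsTriangular.trace_eq [FiniteDimensional ℂ E] {b : OrthonormalBasis (Fin 2) ℂ E}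
    {A : E →ₗ[ℂ] E} {l m t : ℂ} (h : IsTriangular b A l m t) :
    LinearMap.trace ℂ E A = l + m := by
  rw [LinearMap.trace_eq_matrix_trace ℂ b.toBasis A, h.toMatrix_eq]
  simp [Matrix.trace_fin_two]

theorem IsTriangular.traceless [FiniteDimensional ℂ E] {b : OrthonormalBasis (Fin 2) ℂ E}
    {A : E →ₗ[ℂ] E} {l m t : ℂ} (h : IsTriangular b A l m t) :
    IsTriangular b (traceless A) ((l - m) / 2) (-((l - m) / 2)) t := by
  constructor
  · simp only [DavisWielandt.traceless, h.trace_eq, LinearMap.sub_apply, LinearMap.smul_apply,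
      LinearMap.id_apply, h.1]
    module
  · simp only [DavisWielandt.traceless, h.trace_eq, LinearMap.sub_apply, LinearMap.smul_apply,
      LinearMap.id_apply, h.2]
    module

theorem IsTriangular.discD_eq [FiniteDimensional ℂ E] {b : OrthonormalBasis (Fin 2) ℂ E}
    {A : E →ₗ[ℂ] E} {l m t : ℂ} (h : IsTriangular b A l m t) :
    discD A = -((l - m) / 2) ^ 2 := by
  rw [discD, ← LinearMap.det_toMatrix b.toBasis, h.traceless.toMatrix_eq, Matrix.det_fin_two_of]
  ring

theorem IsTriangular.norm_discD [FiniteDimensional ℂ E] {b : OrthonormalBasis (Fin 2) ℂ E}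
    {A : E →ₗ[ℂ] E} {l m t : ℂ} (h : IsTriangular b A l m t) :
    ‖discD A‖ = ‖l - m‖ ^ 2 / 4 := by
  rw [h.discD_eq, norm_neg, norm_pow, norm_div, Complex.norm_ofNat]
  ring

theorem IsTriangular.discU_eq [FiniteDimensional ℂ E] {b : OrthonormalBasis (Fin 2) ℂ E}
    {A : E →ₗ[ℂ] E} {l m t : ℂ} (h : IsTriangular b A l m t) :
    discU A = ‖l - m‖ ^ 2 / 4 + ‖t‖ ^ 2 / 2 := by
  rw [discU, LinearMap.trace_eq_matrix_trace ℂ b.toBasis,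
    LinearMap.toMatrix_comp b.toBasis b.toBasis, LinearMap.toMatrix_adjoint,
    h.traceless.toMatrix_eq]
  obtain ⟨d, hd⟩ : ∃ d, d = (l - m) / 2 := ⟨_, rfl⟩
  rw [← hd, show l - m = 2 * d by rw [hd]; ring, norm_mul, mul_pow]
  simp [Matrix.trace_fin_two, Matrix.mul_apply, Fin.sum_univ_two, Complex.sq_norm,
    Complex.normSq_apply]
  ring

theorem IsTriangular.isStarNormal_iff [FiniteDimensional ℂ E]
    {b : OrthonormalBasis (Fin 2) ℂ E} {A : E →ₗ[ℂ] E} {l m t : ℂ}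
    (h : IsTriangular b A l m t) : IsStarNormal A ↔ t = 0 := by
  have key : IsStarNormal A ↔ star (!![l, t; 0, m]) * !![l, t; 0, m] =
      !![l, t; 0, m] * star (!![l, t; 0, m]) := by
    rw [_root_.isStarNormal_iff, commute_iff_eq, ← (EquivLike.injective (LinearMap.toMatrixOrthonormal b)).eq_iff,
      map_mul, map_mul, map_star, h.toMatrixOrthonormal_eq]
  rw [key, Matrix.star_eq_conjTranspose]
  constructor
  · intro hM
    -- The upper left entry of A*A = AA* reads |l|² = |l|² + |t|².
    have h00 := congrFun (congrFun hM 0) 0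
    simp [Matrix.mul_apply, Fin.sum_univ_two] at h00
    have : t * star t = 0 := by
      simp only [Complex.star_def]
      linear_combination -h00
    simpa using this
  · rintro rfl
    ext i j
    fin_cases i <;> fin_cases j <;> simp [Matrix.mul_apply, Fin.sum_univ_two, mul_comm]

theorem IsTriangular.mem_shellPCK_iff {b : OrthonormalBasis (Fin 2) ℂ E} {A : E →ₗ[ℂ] E}
    {l m t : ℂ} (h : IsTriangular b A l m t) (p : Fin 3 → ℝ) :
    p ∈ shellPCK A ↔ ∃ α β : ℂ, ‖α‖ ^ 2 + ‖β‖ ^ 2 = 1 ∧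
      p = ![(l * ‖α‖ ^ 2 + t * β * star α + m * ‖β‖ ^ 2).re,
        (l * ‖α‖ ^ 2 + t * β * star α + m * ‖β‖ ^ 2).im,
        ‖l * α + t * β‖ ^ 2 + ‖m * β‖ ^ 2] := by
  have hnorm : ∀ x y : ℂ, ‖x • b 0 + y • b 1‖ ^ 2 = ‖x‖ ^ 2 + ‖y‖ ^ 2 := by
    intro x y
    rw [← b.sum_sq_norm_inner_right, Fin.sum_univ_two]
    simp [inner_add_right, inner_smul_right]
  have hA : ∀ x y : ℂ, A (x • b 0 + y • b 1) = (l * x + t * y) • b 0 + (m * y) • b 1 := by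
    intro x y
    rw [map_add, map_smul, map_smul, h.1, h.2]
    module
  have hin : ∀ x y : ℂ, inner ℂ (x • b 0 + y • b 1) (A (x • b 0 + y • b 1)) =
      l * ‖x‖ ^ 2 + t * y * star x + m * ‖y‖ ^ 2 := by
    intro x y
    rw [hA]
    simp
    rw [← Complex.conj_mul', ← Complex.conj_mul']
    ring
  constructor
  · rintro ⟨x, hx, rfl⟩
    have hx' : ‖x‖ ≠ 0 := norm_ne_zero_iff.2 hx
    have hsum := b.sum_repr' (((‖x‖⁻¹ : ℝ) : ℂ) • x)
    rw [Fin.sum_univ_two] at hsum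
    refine ⟨inner ℂ (b 0) (((‖x‖⁻¹ : ℝ) : ℂ) • x), inner ℂ (b 1) (((‖x‖⁻¹ : ℝ) : ℂ) • x),
      ?_, ?_⟩
    · rw [← hnorm, hsum]
      simp [norm_smul, hx']
    · rw [← hin, ← hnorm, ← hA, hsum]
      simp [norm_smul]
      refine ⟨?_, ?_, ?_⟩ <;> field_simp
  · rintro ⟨α, β, h1, rfl⟩
    refine ⟨α • b 0 + β • b 1, ?_, ?_⟩
    · intro h0
      rw [← hnorm, h0] at h1
      simp at h1
    · rw [hin, hnorm, h1, hA, hnorm]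
      simp

end LinearAlgebra

end DavisWielandt

noncomputable section

namespace DavisWielandt

/-! ### The radius formulas, real and extended -/

/-- With r the arsinh value, sinh² r is known; it determines cosh 2r and tanh r, which are then
inverted, the former because r ≥ 0. -/
theorem arcosh_arsinh_artanh {U D : ℝ} (hD : 0 < D) (hU : D ≤ U) :
    1 / 2 * Real.arcosh (U / D) = Real.arsinh √((U - D) / (2 * D)) ∧
      Real.arsinh √((U - D) / (2 * D)) = Real.artanh √((U - D) / (U + D)) := by
  have h0 : 0 ≤ (U - D) / (2 * D) := div_nonneg (by linarith) (by linarith)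
  set r := Real.arsinh √((U - D) / (2 * D)) with hr
  have hr0 : 0 ≤ r := Real.arsinh_nonneg_iff.2 (Real.sqrt_nonneg _)
  have hs : Real.sinh r ^ 2 = (U - D) / (2 * D) := by
    rw [hr, Real.sinh_arsinh, Real.sq_sqrt h0]
  have hc : Real.cosh (2 * r) = U / D := by
    rw [Real.cosh_two_mul, Real.cosh_sq, hs]
    field_simp
    ring
  have ht : Real.tanh r = √((U - D) / (U + D)) := by
    rw [hr, Real.tanh_arsinh, Real.sq_sqrt h0, ← Real.sqrt_div' _ (by positivity)]
    congr 1
    have h1 : U + D ≠ 0 := by linarith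
    rw [show 1 + (U - D) / (2 * D) = (U + D) / (2 * D) by field_simp; ring]
    field_simp
  refine ⟨?_, ?_⟩
  · rw [← hc, Real.arcosh_cosh (by linarith)]
    ring
  · rw [← ht, Real.artanh_tanh]

theorem cosh_half_arcosh_sq {x : ℝ} (hx : 1 ≤ x) :
    Real.cosh (1 / 2 * Real.arcosh x) ^ 2 = (1 + x) / 2 := by
  have h := Real.cosh_two_mul (1 / 2 * Real.arcosh x)
  rw [show 2 * (1 / 2 * Real.arcosh x) = Real.arcosh x by ring, Real.cosh_arcosh hx,
    Real.sinh_sq] at h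
  linarith

theorem extended_values_of_eq_zero :
    ((1 / 2 : ℝ) : EReal) * extArcosh (extRatio 1 0 0) = 0 ∧
      extArsinh (extSqrt (extRatio 0 0 0)) = 0 ∧ extArtanh (extSqrt (extRatio 0 0 0)) = 0 := by
  have h1 : (1 : EReal) ≠ ⊤ := EReal.coe_ne_top 1
  have h0 : (0 : EReal) ≠ 1 := by norm_num
  simp [extRatio, extArcosh, extSqrt, extArsinh, extArtanh, h1, h0]

theorem extended_values_of_pos {U : ℝ} (hU : 0 < U) :
    ((1 / 2 : ℝ) : EReal) * extArcosh (extRatio 1 U 0) = ⊤ ∧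
      extArsinh (extSqrt (extRatio 0 U 0)) = ⊤ ∧ extArtanh (extSqrt (extRatio 0 U U)) = ⊤ := by
  have h1 : (1 : EReal) ≠ ⊤ := EReal.coe_ne_top 1
  refine ⟨?_, ?_, ?_⟩
  · simp only [extRatio, extArcosh, hU.ne', if_true, if_false]
    exact EReal.coe_mul_top_of_pos (by norm_num)
  · simp [extRatio, extSqrt, extArsinh, hU.ne']
  · simp [extRatio, extSqrt, extArtanh, hU.ne', h1]

/-! ### Distance from an h-line in the parabolic model -/

/-- The defect `z - x ^ 2 - y ^ 2` of a point, positive exactly at the ordinary points of the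
parabolic model. -/
def defect (p : Fin 3 → ℝ) : ℝ := p 2 - p 0 ^ 2 - p 1 ^ 2

/-- The value of the polar form of the paraboloid on a point and an asymptotic point. -/
def polar (p : Fin 3 → ℝ) (l : ℂ) : ℝ :=
  defect p + ((p 0 - l.re) ^ 2 + (p 1 - l.im) ^ 2)

theorem mem_ordPCK_iff (p : Fin 3 → ℝ) : p ∈ ordPCK ↔ 0 < defect p := by
  simp only [ordPCK, defect, Set.mem_ofPred_eq]
  constructor <;> intro h <;> linarith

theorem polar_pos {p : Fin 3 → ℝ} (hp : p ∈ ordPCK) (l : ℂ) : 0 < polar p l := by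
  rw [mem_ordPCK_iff] at hp
  unfold polar
  positivity

/-- With u = w - l and v = w - m, the difference of the two sides is the sum of squares (W + u·v)² +
(u × v)². This puts the argument of arcosh in the range [1, ∞). -/
theorem norm_sq_mul_defect_le (p : Fin 3 → ℝ) (l m : ℂ) :
    ‖l - m‖ ^ 2 * defect p ≤ polar p l * polar p m := by
  rw [Complex.sq_norm, Complex.normSq_apply, Complex.sub_re, Complex.sub_im]
  unfold polar
  have h1 := sq_nonneg (defect p + ((p 0 - l.re) * (p 0 - m.re) + (p 1 - l.im) * (p 1 - m.im)))
  have h2 := sq_nonneg ((p 0 - l.re) * (p 1 - m.im) - (p 1 - l.im) * (p 0 - m.re))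
  nlinarith

theorem add_one_pos_of_mem_ordPCK {p : Fin 3 → ℝ} (hp : p ∈ ordPCK) : 0 < p 2 + 1 := by
  have : p 0 ^ 2 + p 1 ^ 2 < p 2 := hp
  nlinarith [sq_nonneg (p 0), sq_nonneg (p 1)]

theorem one_sub_norm_sq_toBCK {p : Fin 3 → ℝ} (hp : 0 < p 2 + 1) :
    1 - toBCK p 0 ^ 2 - toBCK p 1 ^ 2 - toBCK p 2 ^ 2 = defect p * (2 / (p 2 + 1)) ^ 2 := by
  simp [toBCK, defect]
  field_simp
  ring

theorem distPCK_eq {p q : Fin 3 → ℝ} (hp : p ∈ ordPCK) (hq : q ∈ ordPCK) :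
    distPCK p q = Real.arcosh ((p 2 + q 2 - 2 * (p 0 * q 0 + p 1 * q 1)) /
      (2 * √(defect p) * √(defect q))) := by
  have hp2 := add_one_pos_of_mem_ordPCK hp
  have hq2 := add_one_pos_of_mem_ordPCK hq
  have hpd := Real.sqrt_pos.2 ((mem_ordPCK_iff p).1 hp)
  have hqd := Real.sqrt_pos.2 ((mem_ordPCK_iff q).1 hq)
  rw [distPCK, distBCK, one_sub_norm_sq_toBCK hp2, one_sub_norm_sq_toBCK hq2,
    Real.sqrt_mul ((mem_ordPCK_iff p).1 hp).le, Real.sqrt_mul ((mem_ordPCK_iff q).1 hq).le,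
    Real.sqrt_sq (by positivity), Real.sqrt_sq (by positivity)]
  congr 1
  simp [toBCK]
  field_simp
  ring

/-- The point with parameter `s` on the straight line connecting two asymptotic points of the
parabolic model. -/
def chord (l m : ℂ) (s : ℝ) : Fin 3 → ℝ :=
  ![(1 - s) * l.re + s * m.re, (1 - s) * l.im + s * m.im, (1 - s) * ‖l‖ ^ 2 + s * ‖m‖ ^ 2]

theorem mem_line_iff_chord (l m : ℂ) (p : Fin 3 → ℝ) :
    p ∈ (line[ℝ, iotaPCK l, iotaPCK m] : Set (Fin 3 → ℝ)) ↔ ∃ s, p = chord l m s := by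
  rw [SetLike.mem_coe, mem_affineSpan_pair_iff_exists_lineMap_eq]
  refine exists_congr fun s => ?_
  rw [eq_comm, AffineMap.lineMap_apply_module]
  simp [chord, iotaPCK]

theorem defect_chord (l m : ℂ) (s : ℝ) :
    defect (chord l m s) = s * (1 - s) * ‖l - m‖ ^ 2 := by
  simp [defect, chord, Complex.sq_norm, Complex.normSq_apply]
  ring

theorem chord_mem_ordPCK_iff {l m : ℂ} (hlm : l ≠ m) (s : ℝ) :
    chord l m s ∈ ordPCK ↔ 0 < s ∧ s < 1 := by
  have hd : 0 < ‖l - m‖ ^ 2 := by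
    have := norm_pos_iff.2 (sub_ne_zero.2 hlm)
    positivity
  rw [mem_ordPCK_iff, defect_chord, mul_pos_iff_of_pos_right hd]
  constructor
  · intro h
    constructor <;> nlinarith
  · rintro ⟨h0, h1⟩
    exact mul_pos h0 (by linarith)

theorem mem_hLine_iff {l m : ℂ} (hlm : l ≠ m) (p : Fin 3 → ℝ) :
    p ∈ hLine ordPCK (iotaPCK l) (iotaPCK m) ↔ ∃ s, 0 < s ∧ s < 1 ∧ p = chord l m s := by
  rw [hLine, Set.mem_inter_iff, mem_line_iff_chord]
  constructor
  · rintro ⟨⟨s, rfl⟩, hp⟩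
    rw [chord_mem_ordPCK_iff hlm] at hp
    exact ⟨s, hp.1, hp.2, rfl⟩
  · rintro ⟨s, h0, h1, rfl⟩
    exact ⟨⟨s, rfl⟩, (chord_mem_ordPCK_iff hlm s).2 ⟨h0, h1⟩⟩

/-- The argument is written as the root of a square so that the minimisation over `s` takes place
among rational expressions. -/
theorem distPCK_chord {l m : ℂ} (hlm : l ≠ m) {p : Fin 3 → ℝ} (hp : p ∈ ordPCK) {s : ℝ}
    (h0 : 0 < s) (h1 : s < 1) :
    distPCK p (chord l m s) = Real.arcosh √(((1 - s) * polar p l + s * polar p m) ^ 2 /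
      (4 * s * (1 - s)) / (‖l - m‖ ^ 2 * defect p)) := by
  have hW := (mem_ordPCK_iff p).1 hp
  have ha := polar_pos hp l
  have hb := polar_pos hp m
  have h1' : 0 < 1 - s := by linarith
  have hnum : p 2 + chord l m s 2 - 2 * (p 0 * chord l m s 0 + p 1 * chord l m s 1) =
      (1 - s) * polar p l + s * polar p m := by
    simp [chord, polar, defect, Complex.sq_norm, Complex.normSq_apply]
    ring
  rw [distPCK_eq hp ((chord_mem_ordPCK_iff hlm s).2 ⟨h0, h1⟩), defect_chord, hnum]
  congr 1
  symm
  rw [Real.sqrt_eq_iff_mul_self_eq (by positivity) (by positivity), ← sq, div_pow, mul_pow,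
    mul_pow, Real.sq_sqrt hW.le, Real.sq_sqrt (by positivity), div_div]
  congr 1
  ring

/-- The distance of an ordinary point from an h-line is attained. -/
theorem isLeast_distPCK_hLine {l m : ℂ} (hlm : l ≠ m) {p : Fin 3 → ℝ} (hp : p ∈ ordPCK) :
    IsLeast (distPCK p '' hLine ordPCK (iotaPCK l) (iotaPCK m))
      (Real.arcosh √(polar p l * polar p m / (‖l - m‖ ^ 2 * defect p))) := by
  have hW := (mem_ordPCK_iff p).1 hp
  have ha := polar_pos hp l
  have hb := polar_pos hp m
  have hd : 0 < ‖l - m‖ := norm_pos_iff.2 (sub_ne_zero.2 hlm)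
  constructor
  · have hs1 : polar p l / (polar p l + polar p m) < 1 := by
      rw [div_lt_one (by positivity)]
      linarith
    refine ⟨_, (mem_hLine_iff hlm _).2 ⟨_, by positivity, hs1, rfl⟩, ?_⟩
    rw [distPCK_chord hlm hp (by positivity) hs1]
    congr 3
    rw [show 1 - polar p l / (polar p l + polar p m) = polar p m / (polar p l + polar p m) by
      field_simp; ring]
    field_simp
    ring
  · rintro _ ⟨q, hq, rfl⟩
    obtain ⟨s, h0, h1, rfl⟩ := (mem_hLine_iff hlm q).1 hq
    have h1' : 0 < 1 - s := by linarith
    rw [distPCK_chord hlm hp h0 h1, Real.arcosh_le_arcosh (by positivity) (by positivity)]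
    gcongr
    rw [le_div_iff₀ (by positivity)]
    nlinarith [sq_nonneg ((1 - s) * polar p l - s * polar p m)]

theorem mem_equidistantPCK_iff {l m : ℂ} (hlm : l ≠ m) (r : ℝ) (p : Fin 3 → ℝ) :
    p ∈ equidistant ordPCK distPCK (iotaPCK l) (iotaPCK m) r ↔
      0 ≤ r ∧ 0 < defect p ∧
        polar p l * polar p m = Real.cosh r ^ 2 * ‖l - m‖ ^ 2 * defect p := by
  have hd : 0 < ‖l - m‖ := norm_pos_iff.2 (sub_ne_zero.2 hlm)
  simp only [equidistant, Set.mem_ofPred_eq, ← mem_ordPCK_iff]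
  have aux : ∀ hp : p ∈ ordPCK,
      1 ≤ polar p l * polar p m / (‖l - m‖ ^ 2 * defect p) := by
    intro hp
    have hW := (mem_ordPCK_iff p).1 hp
    rw [le_div_iff₀ (by positivity), one_mul]
    exact norm_sq_mul_defect_le p l m
  constructor
  · rintro ⟨hp, hr⟩
    have hW := (mem_ordPCK_iff p).1 hp
    have hr' := hr.unique (isLeast_distPCK_hLine hlm hp).isGLB
    have h1 : 1 ≤ √(polar p l * polar p m / (‖l - m‖ ^ 2 * defect p)) :=
      Real.one_le_sqrt.2 (aux hp)
    refine ⟨hr' ▸ Real.arcosh_nonneg h1, hp, ?_⟩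
    rw [hr', Real.cosh_arcosh h1, Real.sq_sqrt (by linarith [aux hp])]
    field_simp
  · rintro ⟨hr, hp, he⟩
    have hW := (mem_ordPCK_iff p).1 hp
    refine ⟨hp, ?_⟩
    have h := (isLeast_distPCK_hLine hlm hp).isGLB
    rwa [he, mul_assoc, mul_div_assoc, div_self (by positivity), mul_one,
      Real.sqrt_sq (Real.cosh_pos r).le, Real.arcosh_cosh hr] at h

end DavisWielandt

end

noncomputable section

namespace DavisWielandt

/-! ### The shell in the parabolic model -/

theorem polar_chord (l m : ℂ) (s : ℝ) :
    polar (chord l m s) l = s * ‖l - m‖ ^ 2 ∧ polar (chord l m s) m = (1 - s) * ‖l - m‖ ^ 2 := by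
  constructor <;>
  · simp [polar, defect, chord, Complex.sq_norm, Complex.normSq_apply]
    ring

theorem eq_iotaPCK_iff (p : Fin 3 → ℝ) (l : ℂ) :
    p = iotaPCK l ↔ defect p = 0 ∧ polar p l = 0 := by
  constructor
  · rintro rfl
    simp [polar, defect, iotaPCK, Complex.sq_norm, Complex.normSq_apply]
    ring
  · rintro ⟨h1, h2⟩
    rw [polar, h1, zero_add] at h2
    have e0 : p 0 - l.re = 0 := by nlinarith [sq_nonneg (p 0 - l.re), sq_nonneg (p 1 - l.im)]
    have e1 : p 1 - l.im = 0 := by nlinarith [sq_nonneg (p 0 - l.re), sq_nonneg (p 1 - l.im)]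
    rw [sub_eq_zero] at e0 e1
    rw [defect, e0, e1] at h1
    ext i
    fin_cases i
    · exact e0
    · exact e1
    · simp [iotaPCK, Complex.sq_norm, Complex.normSq_apply]
      linarith

/-- The point of the shell of an upper triangular matrix given by a vector `(α, β)`. -/
def shellPoint (l m t α β : ℂ) : Fin 3 → ℝ :=
  ![(l * ‖α‖ ^ 2 + t * β * star α + m * ‖β‖ ^ 2).re,
    (l * ‖α‖ ^ 2 + t * β * star α + m * ‖β‖ ^ 2).im,
    ‖l * α + t * β‖ ^ 2 + ‖m * β‖ ^ 2]

theorem polar_shellPoint_left (l m t : ℂ) {α β : ℂ} (h : ‖α‖ ^ 2 + ‖β‖ ^ 2 = 1) :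
    polar (shellPoint l m t α β) l = ‖β‖ ^ 2 * (‖t‖ ^ 2 + ‖l - m‖ ^ 2) := by
  simp only [Complex.sq_norm, Complex.normSq_apply] at h
  simp [shellPoint, polar, defect, mul_pow, ← Complex.ofReal_pow, Complex.sq_norm, Complex.normSq_apply,
    -Complex.ofReal_add, -Complex.ofReal_mul]
  linear_combination -(l.re ^ 2 + l.im ^ 2) * h

theorem polar_shellPoint_right (l m t : ℂ) {α β : ℂ} (h : ‖α‖ ^ 2 + ‖β‖ ^ 2 = 1) :
    polar (shellPoint l m t α β) m = ‖α * (l - m) + t * β‖ ^ 2 := by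
  simp only [Complex.sq_norm, Complex.normSq_apply] at h
  simp [shellPoint, polar, defect, mul_pow, ← Complex.ofReal_pow, Complex.sq_norm, Complex.normSq_apply,
    -Complex.ofReal_add, -Complex.ofReal_mul]
  linear_combination -(m.re ^ 2 + m.im ^ 2) * h

theorem defect_shellPoint (l m t : ℂ) {α β : ℂ} (h : ‖α‖ ^ 2 + ‖β‖ ^ 2 = 1) :
    defect (shellPoint l m t α β) = ‖β‖ ^ 2 * ‖α * (l - m) + t * β‖ ^ 2 := by
  have h' := h
  simp only [Complex.sq_norm, Complex.normSq_apply] at h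
  -- Multiplying z by |α|² + |β|² = 1 makes the identity homogeneous: it is the Gram determinant of
  -- v and Av written as |det(v, Av)|², valid without normalisation.
  have : shellPoint l m t α β 2 * (‖α‖ ^ 2 + ‖β‖ ^ 2) - shellPoint l m t α β 0 ^ 2 -
      shellPoint l m t α β 1 ^ 2 = ‖β‖ ^ 2 * ‖α * (l - m) + t * β‖ ^ 2 := by
    simp [shellPoint, mul_pow, ← Complex.ofReal_pow, Complex.sq_norm, Complex.normSq_apply,
      -Complex.ofReal_add, -Complex.ofReal_mul]
    ring
  rw [← this, h', mul_one, defect]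

theorem shellPoint_zero_off_diagonal (l m : ℂ) {α β : ℂ} (h : ‖α‖ ^ 2 + ‖β‖ ^ 2 = 1) :
    shellPoint l m 0 α β = chord l m (‖β‖ ^ 2) := by
  have h' : 1 - ‖β‖ ^ 2 = ‖α‖ ^ 2 := by linarith
  ext i
  fin_cases i
  · simp [shellPoint, chord, h', ← Complex.ofReal_pow]
    ring
  · simp [shellPoint, chord, h', ← Complex.ofReal_pow]
    ring
  · simp [shellPoint, chord, h', mul_pow]
    ring

/-- The value of `polar p l` forces |β|² = B. It remains to solve t β ᾱ = w - l + (l - m)B with |α|²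
= 1 - B; the hypothesis says exactly that the moduli agree. The height z then follows from `polar p
l`. -/
theorem eq_shellPoint_of_mul_eq {l m : ℂ} (hlm : l ≠ m) (t : ℂ) {p : Fin 3 → ℝ}
    (hW : 0 < defect p)
    (hab : polar p l * polar p m = (‖t‖ ^ 2 + ‖l - m‖ ^ 2) * defect p) :
    ∃ α β : ℂ, ‖α‖ ^ 2 + ‖β‖ ^ 2 = 1 ∧ p = shellPoint l m t α β := by
  have hd : 0 < ‖l - m‖ := norm_pos_iff.2 (sub_ne_zero.2 hlm)
  have ha := polar_pos ((mem_ordPCK_iff p).2 hW) l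
  set c := ‖t‖ ^ 2 + ‖l - m‖ ^ 2 with hc
  have hc0 : 0 < c := by positivity
  set B := polar p l / c with hB
  have hB0 : 0 < B := by positivity
  have hcB : c * B = polar p l := by rw [hB]; field_simp
  set z : ℂ := ⟨p 0, p 1⟩ with hz
  have key : ‖z - l + (l - m) * B‖ ^ 2 = ‖t‖ ^ 2 * (B * (1 - B)) := by
    apply mul_left_cancel₀ hc0.ne'
    have hab' := hab
    have hcB' := hcB
    have hc' := hc
    simp only [polar] at hab' hcB'
    simp only [Complex.sq_norm (l - m), Complex.normSq_apply, Complex.sub_re,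
      Complex.sub_im] at hc'
    have hN : ‖z - l + (l - m) * B‖ ^ 2 = (p 0 - l.re + (l.re - m.re) * B) ^ 2 +
        (p 1 - l.im + (l.im - m.im) * B) ^ 2 := by
      rw [Complex.sq_norm, Complex.normSq_apply]
      simp [hz, sq]
    have hT : ‖t‖ ^ 2 = c - ((l.re - m.re) * (l.re - m.re) + (l.im - m.im) * (l.im - m.im)) := by
      linarith
    rw [hN, hT]
    linear_combination (2 * ((p 0 - l.re) * (l.re - m.re) + (p 1 - l.im) * (l.im - m.im)) -
      (c - ((l.re - m.re) * (l.re - m.re) + (l.im - m.im) * (l.im - m.im))) + c * B +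
      (defect p + ((p 0 - l.re) ^ 2 + (p 1 - l.im) ^ 2))) * hcB' + hab'
  have fin : ∀ α β : ℂ, ‖α‖ ^ 2 + ‖β‖ ^ 2 = 1 → ‖β‖ ^ 2 = B →
      l * ‖α‖ ^ 2 + t * β * star α + m * ‖β‖ ^ 2 = z → p = shellPoint l m t α β := by
    intro α β h1 hβ hzz
    have hp := polar_shellPoint_left l m t h1
    have e0 : shellPoint l m t α β 0 = p 0 := by
      simp only [shellPoint, hzz]
      rfl
    have e1 : shellPoint l m t α β 1 = p 1 := by
      simp only [shellPoint, hzz]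
      rfl
    rw [hβ, mul_comm B, hcB, polar, polar, defect, defect, e0, e1] at hp
    ext i
    fin_cases i
    · exact e0.symm
    · exact e1.symm
    · change p 2 = shellPoint l m t α β 2
      linarith
  have hβ : ‖((√B : ℝ) : ℂ)‖ ^ 2 = B := by
    rw [Complex.norm_real, Real.norm_eq_abs, sq_abs, Real.sq_sqrt hB0.le]
  have hβ' : ((√B : ℝ) : ℂ) ≠ 0 := by
    rw [Complex.ofReal_ne_zero]
    exact (Real.sqrt_pos.2 hB0).ne'
  -- For t = 0 the equation places no condition on the phase of α, and B ≤ 1 has to be read off from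
  -- W = |l - m|² B (1 - B) > 0. For t ≠ 0 it determines α once β = √B.
  by_cases ht : t = 0
  · subst ht
    have hy : z - l + (l - m) * B = 0 := by simpa using key
    have hB1 : 0 ≤ 1 - B := by
      have hyy : z - l = -((l - m) * B) := by linear_combination hy
      have hpol : polar p l = defect p + ‖z - l‖ ^ 2 := by
        rw [Complex.sq_norm, Complex.normSq_apply]
        simp [polar, hz, sq]
      rw [hyy, norm_neg, norm_mul, Complex.norm_real, mul_pow, Real.norm_eq_abs, sq_abs, ← hcB,
        hc, norm_zero] at hpol
      have : 0 < ‖l - m‖ ^ 2 * B * (1 - B) := by linarith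
      exact (pos_of_mul_pos_right this (by positivity)).le
    have h1 : ‖((√(1 - B) : ℝ) : ℂ)‖ ^ 2 = 1 - B := by
      rw [Complex.norm_real, Real.norm_eq_abs, sq_abs, Real.sq_sqrt hB1]
    refine ⟨((√(1 - B) : ℝ) : ℂ), ((√B : ℝ) : ℂ), by rw [h1, hβ]; ring,
      fin _ _ (by rw [h1, hβ]; ring) hβ ?_⟩
    rw [← Complex.ofReal_pow, ← Complex.ofReal_pow, h1, hβ]
    push_cast
    linear_combination -hy
  · have h1 : ‖star ((z - l + (l - m) * B) / (t * ((√B : ℝ) : ℂ)))‖ ^ 2 = 1 - B := by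
      rw [norm_star, norm_div, div_pow, key, norm_mul, mul_pow, hβ]
      have : ‖t‖ ≠ 0 := norm_ne_zero_iff.2 ht
      field_simp
    refine ⟨star ((z - l + (l - m) * B) / (t * ((√B : ℝ) : ℂ))), ((√B : ℝ) : ℂ),
      by rw [h1, hβ]; ring, fin _ _ (by rw [h1, hβ]; ring) hβ ?_⟩
    rw [← Complex.ofReal_pow, ← Complex.ofReal_pow, h1, hβ, star_star,
      mul_div_cancel₀ _ (mul_ne_zero ht hβ')]
    push_cast
    ring

variable {E : Type*} [NormedAddCommGroup E] [InnerProductSpace ℂ E]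

theorem IsTriangular.mem_shellPCK_iff_polar {b : OrthonormalBasis (Fin 2) ℂ E} {A : E →ₗ[ℂ] E}
    {l m t : ℂ} (h : IsTriangular b A l m t) (hlm : l ≠ m) (p : Fin 3 → ℝ) :
    p ∈ shellPCK A ↔ (0 < defect p ∧
      polar p l * polar p m = (‖t‖ ^ 2 + ‖l - m‖ ^ 2) * defect p) ∨
        p = iotaPCK l ∨ p = iotaPCK m := by
  rw [h.mem_shellPCK_iff]
  change (∃ α β : ℂ, _ ∧ p = shellPoint l m t α β) ↔ _
  have hd : 0 < ‖l - m‖ := norm_pos_iff.2 (sub_ne_zero.2 hlm)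
  constructor
  · rintro ⟨α, β, h1, rfl⟩
    rw [eq_iotaPCK_iff, eq_iotaPCK_iff, polar_shellPoint_left l m t h1,
      polar_shellPoint_right l m t h1, defect_shellPoint l m t h1]
    by_cases hβ : β = 0
    · simp [hβ]
    by_cases hα : α * (l - m) + t * β = 0
    · simp [hα]
    left
    have := norm_pos_iff.2 hβ
    have := norm_pos_iff.2 hα
    exact ⟨by positivity, by ring⟩
  · rintro (⟨hW, hab⟩ | rfl | rfl)
    · exact eq_shellPoint_of_mul_eq hlm t hW hab
    · refine ⟨1, 0, by simp, Eq.symm ?_⟩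
      rw [eq_iotaPCK_iff, polar_shellPoint_left _ _ _ (by simp), defect_shellPoint _ _ _ (by simp)]
      simp
    -- The vector (-t, l - m), normalised, is the eigenvector for `m`.
    · have hc0 : 0 < ‖t‖ ^ 2 + ‖l - m‖ ^ 2 := by positivity
      have h1 : ‖-t / ((√(‖t‖ ^ 2 + ‖l - m‖ ^ 2) : ℝ) : ℂ)‖ ^ 2 +
          ‖(l - m) / ((√(‖t‖ ^ 2 + ‖l - m‖ ^ 2) : ℝ) : ℂ)‖ ^ 2 = 1 := by
        rw [norm_div, norm_div, norm_neg, div_pow, div_pow, Complex.norm_real, Real.norm_eq_abs,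
          sq_abs, Real.sq_sqrt hc0.le]
        field_simp
      refine ⟨_, _, h1, Eq.symm ?_⟩
      rw [eq_iotaPCK_iff, polar_shellPoint_right _ _ _ h1, defect_shellPoint _ _ _ h1]
      rw [show ∀ s : ℂ, -t / s * (l - m) + t * ((l - m) / s) = 0 from fun s => by ring]
      simp

/-- One ordinary point of the shell is enough to determine the radius. The vector is chosen with β =
1 and α(l - m) + tβ = 1, then normalised, so that neither factor of the defect vanishes. -/
theorem IsTriangular.exists_mem_shellPCK {b : OrthonormalBasis (Fin 2) ℂ E} {A : E →ₗ[ℂ] E}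
    {l m t : ℂ} (h : IsTriangular b A l m t) (hlm : l ≠ m) :
    ∃ p ∈ shellPCK A, 0 < defect p := by
  have hd : l - m ≠ 0 := sub_ne_zero.2 hlm
  set α := (1 - t) / (l - m) with hα
  have hn : 0 < ‖α‖ ^ 2 + 1 := by positivity
  set s : ℂ := ((√(‖α‖ ^ 2 + 1) : ℝ) : ℂ) with hs
  have hs2 : ‖s‖ ^ 2 = ‖α‖ ^ 2 + 1 := by
    rw [hs, Complex.norm_real, Real.norm_eq_abs, sq_abs, Real.sq_sqrt hn.le]
  have hs0 : s ≠ 0 := by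
    rw [hs, Complex.ofReal_ne_zero]
    exact (Real.sqrt_pos.2 hn).ne'
  have h1 : ‖α / s‖ ^ 2 + ‖1 / s‖ ^ 2 = 1 := by
    rw [norm_div α, norm_div 1, div_pow, div_pow, hs2, norm_one]
    field_simp
  refine ⟨shellPoint l m t (α / s) (1 / s), (h.mem_shellPCK_iff _).2 ⟨_, _, h1, rfl⟩, ?_⟩
  rw [defect_shellPoint _ _ _ h1, show α / s * (l - m) + t * (1 / s) = 1 / s by
    rw [hα]
    field_simp
    ring]
  have := norm_pos_iff.2 (one_div_ne_zero hs0)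
  positivity

theorem mul_polar_eq_of_isPossiblyDegenerateHTube {l m : ℂ} (hlm : l ≠ m) {r : ℝ}
    {S : Set (Fin 3 → ℝ)}
    (hS : IsPossiblyDegenerateHTube ordPCK distPCK (iotaPCK l) (iotaPCK m) r S) :
    0 ≤ r ∧ ∀ p ∈ S, 0 < defect p →
      polar p l * polar p m = Real.cosh r ^ 2 * ‖l - m‖ ^ 2 * defect p := by
  have hne : ∀ p : Fin 3 → ℝ, 0 < defect p → p ∉ ({iotaPCK l, iotaPCK m} : Set (Fin 3 → ℝ)) := by
    rintro p hp (h | h)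
    · exact hp.ne' ((eq_iotaPCK_iff p l).1 h).1
    · exact hp.ne' ((eq_iotaPCK_iff p m).1 h).1
  rcases hS with ⟨hr, rfl⟩ | ⟨rfl, rfl⟩
  · refine ⟨hr.le, fun p hp hW => ?_⟩
    exact ((mem_equidistantPCK_iff hlm r p).1 (hp.resolve_right (hne p hW))).2.2
  · refine ⟨le_rfl, fun p hp hW => ?_⟩
    obtain ⟨s, -, -, rfl⟩ := (mem_hLine_iff hlm p).1 (hp.resolve_right (hne p hW))
    rw [(polar_chord l m s).1, (polar_chord l m s).2, defect_chord, Real.cosh_zero]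
    ring

/-- Uniqueness compares the two equations at one ordinary point and uses injectivity of cosh on [0,
∞). For existence, R = 0 forces t = 0 and the shell is the closed chord; for R > 0 the shell and
tube equations coincide. -/
theorem IsTriangular.isPossiblyDegenerateHTube_iff {b : OrthonormalBasis (Fin 2) ℂ E}
    {A : E →ₗ[ℂ] E} {l m t : ℂ} (h : IsTriangular b A l m t) (hlm : l ≠ m) {R : ℝ} (hR : 0 ≤ R)
    (hcosh : Real.cosh R ^ 2 * ‖l - m‖ ^ 2 = ‖t‖ ^ 2 + ‖l - m‖ ^ 2) (r : ℝ) :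
    IsPossiblyDegenerateHTube ordPCK distPCK (iotaPCK l) (iotaPCK m) r (shellPCK A) ↔ r = R := by
  have hd : 0 < ‖l - m‖ := norm_pos_iff.2 (sub_ne_zero.2 hlm)
  constructor
  · intro hS
    obtain ⟨hr, hall⟩ := mul_polar_eq_of_isPossiblyDegenerateHTube hlm hS
    obtain ⟨p, hp, hW⟩ := h.exists_mem_shellPCK hlm
    have h1 := hall p hp hW
    have h2 : polar p l * polar p m = (‖t‖ ^ 2 + ‖l - m‖ ^ 2) * defect p := by
      rcases (h.mem_shellPCK_iff_polar hlm p).1 hp with h2 | h2 | h2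
      · exact h2.2
      · exact absurd ((eq_iotaPCK_iff p l).1 h2).1 hW.ne'
      · exact absurd ((eq_iotaPCK_iff p m).1 h2).1 hW.ne'
    rw [h2, ← hcosh] at h1
    have h3 := mul_right_cancel₀ (pow_pos hd 2).ne' (mul_right_cancel₀ hW.ne' h1)
    have h4 : Real.cosh r = Real.cosh R :=
      ((pow_left_inj₀ (Real.cosh_pos R).le (Real.cosh_pos r).le two_ne_zero).1 h3).symm
    exact Real.cosh_injOn hr hR h4
  · rintro rfl
    rcases hR.eq_or_lt with rfl | hR
    · right
      refine ⟨rfl, ?_⟩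
      have ht : t = 0 := by
        rw [Real.cosh_zero] at hcosh
        have : ‖t‖ ^ 2 = 0 := by linarith
        simpa using this
      subst ht
      ext p
      rw [h.mem_shellPCK_iff_polar hlm]
      refine or_congr ⟨fun hp => ?_, fun hp => ?_⟩ Iff.rfl
      · obtain ⟨α, β, h1, rfl⟩ := eq_shellPoint_of_mul_eq hlm 0 hp.1 hp.2
        rw [shellPoint_zero_off_diagonal l m h1] at hp ⊢
        have := (chord_mem_ordPCK_iff hlm _).1 ((mem_ordPCK_iff _).2 hp.1)
        exact (mem_hLine_iff hlm _).2 ⟨_, this.1, this.2, rfl⟩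
      · refine ⟨(mem_ordPCK_iff p).1 hp.2, ?_⟩
        obtain ⟨s, -, -, rfl⟩ := (mem_hLine_iff hlm p).1 hp
        rw [(polar_chord l m s).1, (polar_chord l m s).2, defect_chord, norm_zero]
        ring
    · left
      refine ⟨hR, ?_⟩
      ext p
      rw [h.mem_shellPCK_iff_polar hlm]
      refine or_congr ?_ Iff.rfl
      rw [mem_equidistantPCK_iff hlm, hcosh]
      simp [hR.le]

end DavisWielandt

end

noncomputable section

namespace DavisWielandt

/-! ### Transfer to the Beltrami–Cayley–Klein model -/

theorem toBCK_injOn : Set.InjOn toBCK {p | 0 < p 2 + 1} := by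
  intro p (hp : 0 < p 2 + 1) q (hq : 0 < q 2 + 1) h
  have h0 := congrFun h 0
  have h1 := congrFun h 1
  have h2 := congrFun h 2
  simp only [toBCK, Matrix.cons_val_zero, Matrix.cons_val_one, Matrix.cons_val] at h0 h1 h2
  rw [div_eq_div_iff hp.ne' hq.ne'] at h0 h1 h2
  have e2 : p 2 = q 2 := by linarith
  rw [e2] at h0 h1
  ext i
  fin_cases i
  · have := mul_right_cancel₀ hq.ne' h0
    simpa using this
  · have := mul_right_cancel₀ hq.ne' h1
    simpa using this
  · exact e2

theorem toBCK_mem_ordBCK_iff {p : Fin 3 → ℝ} (hp : 0 < p 2 + 1) :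
    toBCK p ∈ ordBCK ↔ p ∈ ordPCK := by
  have h := one_sub_norm_sq_toBCK hp
  have h2 : 0 < (2 / (p 2 + 1)) ^ 2 := by positivity
  rw [mem_ordPCK_iff, ← mul_pos_iff_of_pos_right h2, ← h, ordBCK, Set.mem_ofPred_eq]
  constructor <;> intro h <;> linarith

theorem toBCK_image_ordPCK : toBCK '' ordPCK = ordBCK := by
  ext q
  constructor
  · rintro ⟨p, hp, rfl⟩
    exact (toBCK_mem_ordBCK_iff (add_one_pos_of_mem_ordPCK hp)).2 hp
  · intro hq
    have hq' : q 0 ^ 2 + q 1 ^ 2 + q 2 ^ 2 < 1 := hq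
    have h1 : 0 < 1 - q 2 := by nlinarith [sq_nonneg (q 0), sq_nonneg (q 1), sq_nonneg (q 2)]
    set p : Fin 3 → ℝ := ![q 0 / (1 - q 2), q 1 / (1 - q 2), (1 + q 2) / (1 - q 2)] with hp
    have e : p 2 + 1 = 2 / (1 - q 2) := by
      simp [hp]
      field_simp
      ring
    have hpq : toBCK p = q := by
      rw [toBCK, e]
      ext i
      fin_cases i <;> simp [hp] <;> field_simp
      ring
    refine ⟨p, (toBCK_mem_ordBCK_iff (by rw [e]; positivity)).1 (hpq ▸ hq), hpq⟩

theorem toBCK_iotaPCK (l : ℂ) : toBCK (iotaPCK l) = iotaBCK l := by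
  simp [toBCK, iotaPCK, iotaBCK]

/-- A projective map preserves lines but not affine parameters: in homogeneous coordinates the
endpoints acquire the weights |l|² + 1 and |m|² + 1. -/
theorem toBCK_chord (l m : ℂ) {s : ℝ} (hs : 0 < chord l m s 2 + 1) :
    toBCK (chord l m s) =
      ((1 - s) * (‖l‖ ^ 2 + 1) / (chord l m s 2 + 1)) • iotaBCK l +
        (s * (‖m‖ ^ 2 + 1) / (chord l m s 2 + 1)) • iotaBCK m := by
  have hl : ‖l‖ ^ 2 + 1 ≠ 0 := by positivity
  have hm : ‖m‖ ^ 2 + 1 ≠ 0 := by positivity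
  simp only [toBCK, iotaBCK]
  ext i
  fin_cases i <;> simp <;> field_simp <;> simp [chord] <;> ring

theorem toBCK_image_hLine {l m : ℂ} (hlm : l ≠ m) :
    toBCK '' hLine ordPCK (iotaPCK l) (iotaPCK m) = hLine ordBCK (iotaBCK l) (iotaBCK m) := by
  ext q
  constructor
  · rintro ⟨p, hp, rfl⟩
    have hpos := add_one_pos_of_mem_ordPCK hp.2
    refine ⟨?_, (toBCK_mem_ordBCK_iff hpos).2 hp.2⟩
    obtain ⟨s, -, -, rfl⟩ := (mem_hLine_iff hlm p).1 hp
    rw [SetLike.mem_coe, mem_affineSpan_pair_iff_exists_lineMap_eq]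
    refine ⟨s * (‖m‖ ^ 2 + 1) / (chord l m s 2 + 1), ?_⟩
    rw [AffineMap.lineMap_apply_module, toBCK_chord l m hpos]
    congr 2
    rw [eq_div_iff hpos.ne', sub_mul, div_mul_cancel₀ _ hpos.ne']
    simp [chord]
    ring
  · rintro ⟨hline, hq⟩
    rw [SetLike.mem_coe, mem_affineSpan_pair_iff_exists_lineMap_eq] at hline
    obtain ⟨u, rfl⟩ := hline
    rw [AffineMap.lineMap_apply_module] at hq ⊢
    have hl : 0 < ‖l‖ ^ 2 + 1 := by positivity
    have hm : 0 < ‖m‖ ^ 2 + 1 := by positivity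
    set a := ‖l‖ ^ 2 + 1 with ha
    set b := ‖m‖ ^ 2 + 1 with hb
    -- Inverting the change of parameter gives s = ua / ((1 - u)b + ua). The denominator is positive
    -- because it is a positive multiple of 1 - q₂, and q lies in the open ball.
    have hden : 0 < (1 - u) * b + u * a := by
      have hq' : _ < (1 : ℝ) := hq
      set q := (1 - u) • iotaBCK l + u • iotaBCK m with hqdef
      have h1 : 0 < 1 - q 2 := by nlinarith [sq_nonneg (q 0), sq_nonneg (q 1), sq_nonneg (q 2)]
      have h2 : 1 - q 2 = 2 * ((1 - u) * b + u * a) / (a * b) := by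
        simp [hqdef, iotaBCK, ← ha, ← hb]
        field_simp
        rw [ha, hb]
        ring
      rw [h2] at h1
      have := (div_pos_iff_of_pos_right (by positivity)).1 h1
      linarith
    have e : chord l m (u * a / ((1 - u) * b + u * a)) 2 + 1 = a * b / ((1 - u) * b + u * a) := by
      simp [chord]
      field_simp
      rw [ha, hb]
      ring
    have hpos : 0 < chord l m (u * a / ((1 - u) * b + u * a)) 2 + 1 := by
      rw [e]
      positivity
    have hpq : toBCK (chord l m (u * a / ((1 - u) * b + u * a))) =
        (1 - u) • iotaBCK l + u • iotaBCK m := by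
      rw [toBCK_chord l m hpos, e, ← ha, ← hb]
      congr 2
      · field_simp
        ring
      · field_simp
    refine ⟨_, ⟨(mem_line_iff_chord l m _).2 ⟨_, rfl⟩, ?_⟩, hpq⟩
    rw [← toBCK_mem_ordBCK_iff hpos, hpq]
    exact hq

theorem toBCK_image_equidistant {l m : ℂ} (hlm : l ≠ m) (r : ℝ) :
    toBCK '' equidistant ordPCK distPCK (iotaPCK l) (iotaPCK m) r =
      equidistant ordBCK distBCK (iotaBCK l) (iotaBCK m) r := by
  have key : ∀ p, distBCK (toBCK p) '' hLine ordBCK (iotaBCK l) (iotaBCK m) =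
      distPCK p '' hLine ordPCK (iotaPCK l) (iotaPCK m) := by
    intro p
    rw [← toBCK_image_hLine hlm, Set.image_image]
    rfl
  ext q
  constructor
  · rintro ⟨p, ⟨hp, hr⟩, rfl⟩
    refine ⟨toBCK_image_ordPCK ▸ Set.mem_image_of_mem _ hp, ?_⟩
    rwa [key]
  · rintro ⟨hq, hr⟩
    rw [← toBCK_image_ordPCK] at hq
    obtain ⟨p, hp, rfl⟩ := hq
    refine ⟨p, ⟨hp, ?_⟩, rfl⟩
    rwa [key] at hr

/-- All sets involved lie in the half-space z > -1, where `toBCK` is injective, so equality of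
images is equality of sets. -/
theorem isPossiblyDegenerateHTube_toBCK_image_iff {l m : ℂ} (hlm : l ≠ m) (r : ℝ)
    {S : Set (Fin 3 → ℝ)} (hS : ∀ p ∈ S, 0 < p 2 + 1) :
    IsPossiblyDegenerateHTube ordBCK distBCK (iotaBCK l) (iotaBCK m) r (toBCK '' S) ↔
      IsPossiblyDegenerateHTube ordPCK distPCK (iotaPCK l) (iotaPCK m) r S := by
  have key : ∀ T : Set (Fin 3 → ℝ), T ⊆ ordPCK →
      (toBCK '' S = toBCK '' T ∪ {iotaBCK l, iotaBCK m} ↔ S = T ∪ {iotaPCK l, iotaPCK m}) := by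
    intro T hT
    rw [← toBCK_iotaPCK, ← toBCK_iotaPCK, ← Set.image_pair, ← Set.image_union]
    refine toBCK_injOn.image_eq_image_iff hS ?_
    rintro p (hp | rfl | rfl)
    · exact add_one_pos_of_mem_ordPCK (hT hp)
    · change 0 < ‖l‖ ^ 2 + 1
      positivity
    · change 0 < ‖m‖ ^ 2 + 1
      positivity
  rw [IsPossiblyDegenerateHTube, IsPossiblyDegenerateHTube, IsClosedHTube, IsClosedHTube,
    ← toBCK_image_equidistant hlm, ← toBCK_image_hLine hlm, key _ fun p hp => hp.1,
    key _ fun p hp => hp.2]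

variable {E : Type*} [NormedAddCommGroup E] [InnerProductSpace ℂ E]

theorem toBCK_image_shellPCK (A : E →ₗ[ℂ] E) : toBCK '' shellPCK A = shellBCK A := by
  have key : ∀ x : E, x ≠ 0 → toBCK ![(inner ℂ x (A x)).re / ‖x‖ ^ 2,
      (inner ℂ x (A x)).im / ‖x‖ ^ 2, ‖A x‖ ^ 2 / ‖x‖ ^ 2] =
      ![2 * (inner ℂ x (A x)).re / (‖A x‖ ^ 2 + ‖x‖ ^ 2),
      2 * (inner ℂ x (A x)).im / (‖A x‖ ^ 2 + ‖x‖ ^ 2),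
      (‖A x‖ ^ 2 - ‖x‖ ^ 2) / (‖A x‖ ^ 2 + ‖x‖ ^ 2)] := by
    intro x hx
    have hx' : 0 < ‖x‖ := norm_pos_iff.2 hx
    have h1 : ‖A x‖ ^ 2 + ‖x‖ ^ 2 ≠ 0 := by positivity
    ext i
    fin_cases i <;> simp [toBCK] <;> field_simp
  ext q
  constructor
  · rintro ⟨_, ⟨x, hx, rfl⟩, rfl⟩
    exact ⟨x, hx, key x hx⟩
  · rintro ⟨x, hx, rfl⟩
    exact ⟨_, ⟨x, hx, rfl⟩, key x hx⟩

theorem add_one_pos_of_mem_shellPCK {A : E →ₗ[ℂ] E} {p : Fin 3 → ℝ} (hp : p ∈ shellPCK A) :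
    0 < p 2 + 1 := by
  obtain ⟨x, -, rfl⟩ := hp
  change 0 < ‖A x‖ ^ 2 / ‖x‖ ^ 2 + 1
  positivity

end DavisWielandt

end

/-! ### The main theorem -/

theorem mainTheorem9 {E : Type*} [NormedAddCommGroup E] [InnerProductSpace ℂ E]
    [FiniteDimensional ℂ E] (hE : Module.finrank ℂ E = 2) (A : E →ₗ[ℂ] E) :
    -- two different eigenvalues
    (∀ l₁ l₂ : ℂ, l₁ ≠ l₂ →
      Module.End.HasEigenvalue A l₁ → Module.End.HasEigenvalue A l₂ →
      0 < ‖DavisWielandt.discD A‖ ∧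
      ‖DavisWielandt.discD A‖ ≤ DavisWielandt.discU A ∧
      (∀ r : ℝ,
        DavisWielandt.IsPossiblyDegenerateHTube DavisWielandt.ordBCK DavisWielandt.distBCK
            (DavisWielandt.iotaBCK l₁) (DavisWielandt.iotaBCK l₂) r (DavisWielandt.shellBCK A) ↔
          r = 1 / 2 * Real.arcosh (DavisWielandt.discU A / ‖DavisWielandt.discD A‖)) ∧
      (∀ r : ℝ,
        DavisWielandt.IsPossiblyDegenerateHTube DavisWielandt.ordPCK DavisWielandt.distPCK
            (DavisWielandt.iotaPCK l₁) (DavisWielandt.iotaPCK l₂) r (DavisWielandt.shellPCK A) ↔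
          r = 1 / 2 * Real.arcosh (DavisWielandt.discU A / ‖DavisWielandt.discD A‖)) ∧
      1 / 2 * Real.arcosh (DavisWielandt.discU A / ‖DavisWielandt.discD A‖) =
        Real.arsinh √((DavisWielandt.discU A - ‖DavisWielandt.discD A‖) /
          (2 * ‖DavisWielandt.discD A‖)) ∧
      Real.arsinh √((DavisWielandt.discU A - ‖DavisWielandt.discD A‖) /
          (2 * ‖DavisWielandt.discD A‖)) =
        Real.artanh √((DavisWielandt.discU A - ‖DavisWielandt.discD A‖) /
          (DavisWielandt.discU A + ‖DavisWielandt.discD A‖)) ∧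
      (1 / 2 * Real.arcosh (DavisWielandt.discU A / ‖DavisWielandt.discD A‖) = 0 ↔
        IsStarNormal A)) ∧
    -- a double eigenvalue
    (∀ l : ℂ, (∀ m : ℂ, Module.End.HasEigenvalue A m ↔ m = l) →
      (IsStarNormal A →
        DavisWielandt.discU A = 0 ∧ DavisWielandt.discD A = 0 ∧
        ((1 / 2 : ℝ) : EReal) * DavisWielandt.extArcosh
          (DavisWielandt.extRatio 1 (DavisWielandt.discU A) ‖DavisWielandt.discD A‖) = 0 ∧
        DavisWielandt.extArsinh (DavisWielandt.extSqrt (DavisWielandt.extRatio 0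
          (DavisWielandt.discU A - ‖DavisWielandt.discD A‖) (2 * ‖DavisWielandt.discD A‖))) = 0 ∧
        DavisWielandt.extArtanh (DavisWielandt.extSqrt (DavisWielandt.extRatio 0
          (DavisWielandt.discU A - ‖DavisWielandt.discD A‖)
          (DavisWielandt.discU A + ‖DavisWielandt.discD A‖))) = 0) ∧
      (¬ IsStarNormal A →
        0 < DavisWielandt.discU A ∧ DavisWielandt.discD A = 0 ∧
        ((1 / 2 : ℝ) : EReal) * DavisWielandt.extArcosh
          (DavisWielandt.extRatio 1 (DavisWielandt.discU A) ‖DavisWielandt.discD A‖) = ⊤ ∧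
        DavisWielandt.extArsinh (DavisWielandt.extSqrt (DavisWielandt.extRatio 0
          (DavisWielandt.discU A - ‖DavisWielandt.discD A‖) (2 * ‖DavisWielandt.discD A‖))) = ⊤ ∧
        DavisWielandt.extArtanh (DavisWielandt.extSqrt (DavisWielandt.extRatio 0
          (DavisWielandt.discU A - ‖DavisWielandt.discD A‖)
          (DavisWielandt.discU A + ‖DavisWielandt.discD A‖))) = ⊤)) := by 
  constructor
  · intro l₁ l₂ hne h₁ h₂
    obtain ⟨b, m, t, h⟩ := DavisWielandt.exists_isTriangular hE h₁
    obtain rfl : l₂ = m := (h.eq_or_eq h₂).resolve_left hne.symm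
    have hd : 0 < ‖l₁ - l₂‖ := norm_pos_iff.2 (sub_ne_zero.2 hne)
    have hD : 0 < ‖DavisWielandt.discD A‖ := by
      rw [h.norm_discD]
      positivity
    have hDU : ‖DavisWielandt.discD A‖ ≤ DavisWielandt.discU A := by
      rw [h.norm_discD, h.discU_eq]
      linarith [sq_nonneg ‖t‖]
    have h1 : 1 ≤ DavisWielandt.discU A / ‖DavisWielandt.discD A‖ := (one_le_div hD).2 hDU
    have hR : 0 ≤ 1 / 2 * Real.arcosh (DavisWielandt.discU A / ‖DavisWielandt.discD A‖) :=
      mul_nonneg (by norm_num) (Real.arcosh_nonneg h1)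
    -- By the half-angle formula cosh² R = (1 + U/|D|)/2, where U/|D| = 1 + 2|t|²/|l₁ - l₂|².
    have hcosh : Real.cosh (1 / 2 * Real.arcosh
        (DavisWielandt.discU A / ‖DavisWielandt.discD A‖)) ^ 2 * ‖l₁ - l₂‖ ^ 2 =
        ‖t‖ ^ 2 + ‖l₁ - l₂‖ ^ 2 := by
      rw [DavisWielandt.cosh_half_arcosh_sq h1, h.norm_discD, h.discU_eq]
      field_simp
      ring
    refine ⟨hD, hDU, fun r => ?_, h.isPossiblyDegenerateHTube_iff hne hR hcosh,
      (DavisWielandt.arcosh_arsinh_artanh hD hDU).1,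
      (DavisWielandt.arcosh_arsinh_artanh hD hDU).2, ?_⟩
    · rw [← DavisWielandt.toBCK_image_shellPCK,
        DavisWielandt.isPossiblyDegenerateHTube_toBCK_image_iff hne r
          fun p hp => DavisWielandt.add_one_pos_of_mem_shellPCK hp]
      exact h.isPossiblyDegenerateHTube_iff hne hR hcosh r
    · rw [h.isStarNormal_iff, mul_eq_zero_iff_left (by norm_num), Real.arcosh_eq_zero_iff h1,
        div_eq_one_iff_eq hD.ne', h.norm_discD, h.discU_eq]
      simp
  · intro l hl
    obtain ⟨b, m, t, h⟩ := DavisWielandt.exists_isTriangular hE ((hl l).2 rfl)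
    obtain rfl : m = l := (hl m).1 h.hasEigenvalue
    have hD : DavisWielandt.discD A = 0 := by
      rw [h.discD_eq]
      simp
    have hU : DavisWielandt.discU A = ‖t‖ ^ 2 / 2 := by
      rw [h.discU_eq]
      simp
    constructor
    · intro hA
      have hU0 : DavisWielandt.discU A = 0 := by
        rw [hU, h.isStarNormal_iff.1 hA]
        simp
      refine ⟨hU0, hD, ?_⟩
      simpa only [hU0, hD, norm_zero, sub_zero, add_zero, mul_zero] using
        DavisWielandt.extended_values_of_eq_zero
    · intro hA
      have hU0 : 0 < DavisWielandt.discU A := by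
        have := norm_pos_iff.2 (h.isStarNormal_iff.not.1 hA)
        rw [hU]
        positivity
      refine ⟨hU0, hD, ?_⟩
      simpa only [hD, norm_zero, sub_zero, add_zero, mul_zero] using
        DavisWielandt.extended_values_of_pos hU0
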